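/- Let $G$ be a (real, smooth) $5$-dimensional Lie group whose Lie algebra is abelian, i.e. isomorphic to $5A_1\cong\mathbb{R}^5$ with zero bracket. Let $T$ be a left-invariant symmetric tensor field of type $(0,2)$ on $G$. There exists a pair $(g,t)$, where $g$ is a left-invariant Riemannian metric on $G$ and $t$ is a non-zero real constant, such that $\mathrm{Ric}(g)=t^2T$, if and only if $T=0$. Moreover, every left-invariant Riemannian metric on $G$ is flat: the curvature tensor of its Levi-Civita connection vanishes identically. -/

import Mathlib

open Bundle Manifold
open scoped ContDiff

noncomputable section

section Riemannian

variable {E : Type*} [NormedAddCommGroup E] [NormedSpace ℝ E] [FiniteDimensional ℝ E]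
  {H : Type*} [TopologicalSpace H] {I : ModelWithCorners ℝ E H}
  {M : Type*} [TopologicalSpace M] [ChartedSpace H M] [IsManifold I ∞ M]

variable (I M) in
/-- Smooth Riemannian metrics on the manifold `M`. -/
abbrev SmoothRiemannianMetric : Type _ :=
  ContMDiffRiemannianMetric I ∞ E (fun x : M => TangentSpace I x)

variable (I M) in
/-- Affine connections on `M`: covariant derivatives on the tangent bundle.
`D Z x v` is the derivative `∇_v Z` at the point `x`. -/
abbrev AffineConnection : Type _ :=
  CovariantDerivative I E (fun x : M => TangentSpace I x)

/-- `D` is the Levi-Civita connection of `g`: it is torsion free and compatible with `g`, that is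
`d(g(Y, Z))(v) = g(∇_v Y, Z) + g(Y, ∇_v Z)`. (Levi-Civita connections agree on differentiable
vector fields; `D` is unconstrained on the others.) -/
def IsLeviCivita (g : SmoothRiemannianMetric I M) (D : AffineConnection I M) : Prop :=
  D.torsion = 0 ∧
    ∀ (x : M) (v : TangentSpace I x) (Y Z : Π y : M, TangentSpace I y),
      MDifferentiableAt I I.tangent (fun y => (⟨y, Y y⟩ : TangentBundle I M)) x →
      MDifferentiableAt I I.tangent (fun y => (⟨y, Z y⟩ : TangentBundle I M)) x →
      mvfderiv I (fun y => g.inner y (Y y) (Z y)) x v =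
        g.inner x (D Y x v) (Z x) + g.inner x (Y x) (D Z x v)

/-- The curvature `R(X, Y) Z = ∇_X ∇_Y Z - ∇_Y ∇_X Z - ∇_{[X, Y]} Z` on vector fields. -/
def curvature (D : AffineConnection I M) (X Y Z : Π x : M, TangentSpace I x) (x : M) :
    TangentSpace I x :=
  D (fun y => D Z y (Y y)) x (X x) - D (fun y => D Z y (X y)) x (Y x)
    - D Z x (VectorField.mlieBracket I X Y x)

/-- The curvature at `x` on tangent vectors `u, v, w`, computed on extensions of these vectors that
are smooth near `x` (by tensoriality the choice of the extensions is immaterial). -/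
def curvatureAt (D : AffineConnection I M) (x : M) (u v w : TangentSpace I x) :
    TangentSpace I x :=
  curvature D (FiberBundle.extend E u) (FiberBundle.extend E v) (FiberBundle.extend E w) x

/-- The Ricci curvature `Ric(u, v)`, the trace of `w ↦ R(w, u) v`. -/
def ricciAt (D : AffineConnection I M) (x : M) (u v : TangentSpace I x) : ℝ :=
  ∑ i, (Module.finBasis ℝ E).repr (curvatureAt D x (Module.finBasis ℝ E i) u v) i

/-- `Ric(g) = S` for a field `S` of bilinear forms: `g` has a Levi-Civita connection, and
the Ricci curvature computed from it is `S`. -/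
def HasRicciCurvature (g : SmoothRiemannianMetric I M)
    (S : Π x : M, TangentSpace I x →L[ℝ] TangentSpace I x →L[ℝ] ℝ) : Prop :=
  (∃ D : AffineConnection I M, IsLeviCivita g D) ∧
    ∀ D : AffineConnection I M, IsLeviCivita g D →
      ∀ (x : M) (u v : TangentSpace I x), ricciAt D x u v = S x u v

/-- `g` is flat: `g` has a Levi-Civita connection, and its curvature vanishes on all
smooth vector fields. -/
def IsFlatMetric (g : SmoothRiemannianMetric I M) : Prop :=
  (∃ D : AffineConnection I M, IsLeviCivita g D) ∧
    ∀ D : AffineConnection I M, IsLeviCivita g D →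
      ∀ X Y Z : Π x : M, TangentSpace I x,
        ContMDiff I I.tangent ∞ (fun x => (⟨x, X x⟩ : TangentBundle I M)) →
        ContMDiff I I.tangent ∞ (fun x => (⟨x, Y x⟩ : TangentBundle I M)) →
        ContMDiff I I.tangent ∞ (fun x => (⟨x, Z x⟩ : TangentBundle I M)) →
        ∀ x : M, curvature D X Y Z x = 0

end Riemannian

section LeftInvariant

variable {E : Type*} [NormedAddCommGroup E] [NormedSpace ℝ E]
  {H : Type*} [TopologicalSpace H] {I : ModelWithCorners ℝ E H}
  {G : Type*} [TopologicalSpace G] [ChartedSpace H G] [Group G]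

/-- A `(0, 2)`-tensor field `S` on a Lie group is left-invariant: every left translation
`L_a` satisfies `L_a^* S = S`. (On a Lie group such a field is automatically smooth.) -/
def IsLeftInvariantTensor
    (S : Π x : G, TangentSpace I x →L[ℝ] TangentSpace I x →L[ℝ] ℝ) : Prop :=
  ∀ (a x : G) (u v : TangentSpace I x),
    S (a * x) (mfderiv I I (fun y => a * y) x u) (mfderiv I I (fun y => a * y) x v) = S x u v

end LeftInvariant

end

/-! Extend an orthonormal basis of the tangent space at the identity to left-invariant fields `e i`.
They are orthonormal everywhere because the metric is left-invariant, and they commute because the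
Lie algebra is abelian (`exists_isCommutingOrthonormalFrame`). The connection making every `e i`
parallel is then metric and torsion-free. On a field `Z` it only differentiates the coefficients
`g(Z, e i)`, so its curvature is the defect in `X Y f - Y X f = [X, Y] f`, which is zero
(`mvfderiv_mvfderiv_sub_swap`).

Flatness and Ricci curvature quantify over all Levi-Civita connections, so uniqueness on
differentiable fields (`IsLeviCivita.eq_of_mdifferentiableAt`) carries the result over to each of
them. Hence `t² T = Ric(g) = 0` forces `T = 0`. The converse needs only some left-invariant metric
(`exists_leftInvariant_metric`). -/

/-! ### Vector fields as derivations. -/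

section Calculus

open VectorField

variable {E : Type*} [NormedAddCommGroup E] [NormedSpace ℝ E] [FiniteDimensional ℝ E]
  {H : Type*} [TopologicalSpace H] {I : ModelWithCorners ℝ E H}
  {M : Type*} [TopologicalSpace M] [ChartedSpace H M] [IsManifold I ∞ M]

/-- A function is differentiable if its product with a local frame field is. -/
lemma mdifferentiableAt_of_smul_localFrame {ι : Type*} [Fintype ι] (b : Module.Basis ι ℝ E) (i : ι)
    {x : M} {h : M → ℝ}
    (hh : MDifferentiableAt I (I.prod 𝓘(ℝ, E)) (fun y => (⟨y, h y •
      (trivializationAt E (TangentSpace I) x).localFrame b i y⟩ : TangentBundle I M)) x) :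
    MDifferentiableAt I 𝓘(ℝ) h x := by
  set e := trivializationAt E (TangentSpace I : M → Type _) x
  have hx : x ∈ e.baseSet := mem_baseSet_trivializationAt E (TangentSpace I) x
  refine (mdifferentiableAt_localFrameCoeff (I := I) b hx hh i).congr_of_eventuallyEq ?_
  filter_upwards [e.open_baseSet.mem_nhds hx] with y hy
  have := e.localFrameCoeff_apply_of_mem_baseSet (I := I) b hy
    (fun y => h y • e.localFrame b i y) i
  rw [LinearMap.piApply_apply]
  refine Eq.trans ?_ this.symm
  simp [hy]

/-- Product rule for the Lie bracket: `[Y, f Z] = (Y f) Z + f [Y, Z]` near `x`. -/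
lemma mlieBracket_smul_right_eventuallyEq {x : M} {f : M → ℝ} {Y Z : Π y : M, TangentSpace I y}
    (hf : ContMDiffAt I 𝓘(ℝ) 2 f x)
    (hZ : ContMDiffAt I (I.prod 𝓘(ℝ, E)) 2 (fun y => (⟨y, Z y⟩ : TangentBundle I M)) x) :
    mlieBracket I Y (f • Z) =ᶠ[nhds x]
      (fun y => mvfderiv I f y (Y y)) • Z + f • mlieBracket I Y Z := by
  filter_upwards [(contMDiffAt_iff_contMDiffAt_nhds (by simp)).1 hf,
    (contMDiffAt_iff_contMDiffAt_nhds (by simp)).1 hZ] with y hfy hZy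
  exact mlieBracket_smul_right (hfy.mdifferentiableAt (by simp)) (hZy.mdifferentiableAt (by simp))

lemma mdifferentiableAt_mlieBracket {x : M} {Y Z : Π y : M, TangentSpace I y}
    (hY : ContMDiffAt I (I.prod 𝓘(ℝ, E)) 2 (fun y => (⟨y, Y y⟩ : TangentBundle I M)) x)
    (hZ : ContMDiffAt I (I.prod 𝓘(ℝ, E)) 2 (fun y => (⟨y, Z y⟩ : TangentBundle I M)) x) :
    MDifferentiableAt I (I.prod 𝓘(ℝ, E))
      (fun y => (⟨y, mlieBracket I Y Z y⟩ : TangentBundle I M)) x := by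
  have : IsManifold I (((2 : ℕ∞) : WithTop ℕ∞) + 1) M := inferInstanceAs (IsManifold I 3 M)
  have : IsManifold I (minSmoothness ℝ 2) M := by
    rw [minSmoothness_of_isRCLikeNormedField]; infer_instance
  exact (ContMDiffAt.mlieBracket_vectorField (n := 2) (m := 1) hY hZ
    (by simp; norm_num)).mdifferentiableAt (by simp)

/-- The derivative of a `C²` function along a `C²` vector field is differentiable. -/
lemma mdifferentiableAt_mvfderiv_apply {x : M} {f : M → ℝ} {Y : Π y : M, TangentSpace I y}
    (hf : ContMDiffAt I 𝓘(ℝ) 2 f x)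
    (hY : ContMDiffAt I (I.prod 𝓘(ℝ, E)) 2 (fun y => (⟨y, Y y⟩ : TangentBundle I M)) x) :
    MDifferentiableAt I 𝓘(ℝ) (fun y => mvfderiv I f y (Y y)) x := by
  rcases subsingleton_or_nontrivial E with hE | hE
  · have : (fun y => mvfderiv I f y (Y y)) = fun _ => 0 := by
      funext y
      rw [show Y y = 0 from @Subsingleton.elim E hE _ _, map_zero]
    rw [this]
    exact mdifferentiableAt_const
  set b := Module.finBasis ℝ E
  let i : Fin (Module.finrank ℝ E) := ⟨0, Module.finrank_pos⟩
  set e := trivializationAt E (TangentSpace I : M → Type _) x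
  have hx : x ∈ e.baseSet := mem_baseSet_trivializationAt E (TangentSpace I) x
  have hZ : ContMDiffAt I (I.prod 𝓘(ℝ, E)) 2
      (fun y => (⟨y, e.localFrame b i y⟩ : TangentBundle I M)) x :=
    contMDiffAt_localFrame_of_mem 2 e b i hx
  -- With `Z` a frame field, `(Y f) Z = [Y, f Z] - f [Y, Z]`, and both terms on the right are
  -- differentiable.
  apply mdifferentiableAt_of_smul_localFrame b i
  have h1 := mdifferentiableAt_mlieBracket hY (hf.smul_section hZ)
  have h2 := (hf.mdifferentiableAt (by simp)).smul_section (mdifferentiableAt_mlieBracket hY hZ)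
  refine (mdifferentiableAt_sub_section h1 h2).congr_of_eventuallyEq ?_
  filter_upwards [mlieBracket_smul_right_eventuallyEq (Y := Y) hf hZ] with y hy
  simp only [Pi.sub_apply, hy, Pi.add_apply, Pi.smul_apply', add_sub_cancel_right]
  rfl

/-- The Lie bracket acts on functions as the commutator of derivations. -/
lemma mvfderiv_mvfderiv_sub_swap {x : M} {f : M → ℝ} {X Y : Π y : M, TangentSpace I y}
    (hf : ContMDiffAt I 𝓘(ℝ) 2 f x)
    (hX : ContMDiffAt I (I.prod 𝓘(ℝ, E)) 2 (fun y => (⟨y, X y⟩ : TangentBundle I M)) x)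
    (hY : ContMDiffAt I (I.prod 𝓘(ℝ, E)) 2 (fun y => (⟨y, Y y⟩ : TangentBundle I M)) x) :
    mvfderiv I (fun y => mvfderiv I f y (Y y)) x (X x)
        - mvfderiv I (fun y => mvfderiv I f y (X y)) x (Y x)
      = mvfderiv I f x (mlieBracket I X Y x) := by
  have : IsManifold I (minSmoothness ℝ 3) M := by
    rw [minSmoothness_of_isRCLikeNormedField]; infer_instance
  rcases subsingleton_or_nontrivial E with hE | hE
  · rw [show X x = 0 from @Subsingleton.elim E hE _ _,
      show Y x = 0 from @Subsingleton.elim E hE _ _,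
      show mlieBracket I X Y x = 0 from @Subsingleton.elim E hE _ _]
    simp
  obtain ⟨v, hv⟩ := exists_ne (0 : E)
  let Z : Π y : M, TangentSpace I y := FiberBundle.extend E (show TangentSpace I x from v)
  have hZx : Z x = v := FiberBundle.extend_apply_self ..
  have hZ : ContMDiffAt I (I.prod 𝓘(ℝ, E)) 2 (fun y => (⟨y, Z y⟩ : TangentBundle I M)) x :=
    FiberBundle.contMDiffAt_extend ..
  have hfd := hf.mdifferentiableAt (by simp)
  -- Expand the Jacobi identity for `X, Y, f Z` by the product rule and subtract `f` times the one
  -- for `X, Y, Z`. What remains is `(X Y f - Y X f - [X, Y] f) Z = 0`, with `Z x ≠ 0`.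
  have key (U V : Π y : M, TangentSpace I y)
      (hU : ContMDiffAt I (I.prod 𝓘(ℝ, E)) 2 (fun y => (⟨y, U y⟩ : TangentBundle I M)) x)
      (hV : ContMDiffAt I (I.prod 𝓘(ℝ, E)) 2 (fun y => (⟨y, V y⟩ : TangentBundle I M)) x) :
      mlieBracket I U (mlieBracket I V (f • Z)) x =
        mvfderiv I (fun y => mvfderiv I f y (V y)) x (U x) • Z x
          + mvfderiv I f x (V x) • mlieBracket I U Z x
          + (mvfderiv I f x (U x) • mlieBracket I V Z x
          + f x • mlieBracket I U (mlieBracket I V Z) x) := by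
    have hVf := mdifferentiableAt_mvfderiv_apply hf hV
    have hZd := hZ.mdifferentiableAt (by simp)
    have hVZ := mdifferentiableAt_mlieBracket hV hZ
    rw [Filter.EventuallyEq.mlieBracket_vectorField_eq (V := U) (V₁ := U) Filter.EventuallyEq.rfl
      (mlieBracket_smul_right_eventuallyEq (Y := V) hf hZ),
      mlieBracket_add_right (hVf.smul_section hZd) (hfd.smul_section hVZ),
      mlieBracket_smul_right hVf hZd, mlieBracket_smul_right hfd hVZ]
  have jac (W : Π y : M, TangentSpace I y)
      (hW : ContMDiffAt I (I.prod 𝓘(ℝ, E)) 2 (fun y => (⟨y, W y⟩ : TangentBundle I M)) x) :=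
    leibniz_identity_mlieBracket_apply (I := I) (U := X) (V := Y) (W := W) (x := x)
      (by simpa using hX) (by simpa using hY) (by simpa using hW)
  have h1 := jac _ (hf.smul_section hZ)
  have h2 := jac Z hZ
  have h3 : mlieBracket I (mlieBracket I X Y) (f • Z) x = _ :=
    mlieBracket_smul_right hfd (hZ.mdifferentiableAt (by simp))
  change mlieBracket I X (mlieBracket I Y (f • Z)) x = mlieBracket I (mlieBracket I X Y) (f • Z) x
    + mlieBracket I Y (mlieBracket I X (f • Z)) x at h1
  rw [key X Y hX hY, key Y X hY hX, h3, h2] at h1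
  have h4 : (mvfderiv I (fun y => mvfderiv I f y (Y y)) x (X x)
        - mvfderiv I (fun y => mvfderiv I f y (X y)) x (Y x)
      - mvfderiv I f x (mlieBracket I X Y x)) • Z x = 0 := by
    linear_combination (norm := module) h1
  rcases smul_eq_zero.1 h4 with h | h
  · exact sub_eq_zero.1 h
  · exact absurd (hZx.symm.trans h) hv

end Calculus

/-! ### Levi-Civita connections and commuting orthonormal frames. -/

section OrthonormalFrame

open VectorField

variable {E : Type*} [NormedAddCommGroup E] [NormedSpace ℝ E]
  {H : Type*} [TopologicalSpace H] {I : ModelWithCorners ℝ E H}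
  {M : Type*} [TopologicalSpace M] [ChartedSpace H M]

lemma mdifferentiableAt_finset_sum {ι : Type*} {s : Finset ι} {f : ι → M → ℝ} {x : M}
    (hf : ∀ i ∈ s, MDifferentiableAt I 𝓘(ℝ) (f i) x) :
    MDifferentiableAt I 𝓘(ℝ) (fun y => ∑ i ∈ s, f i y) x := by
  classical
  induction s using Finset.induction_on with
  | empty => simpa using mdifferentiableAt_const
  | insert a s ha ih =>
    simp only [Finset.sum_insert ha]
    exact (hf a (by simp)).add (ih fun i hi => hf i (by simp [hi]))

lemma mvfderiv_finset_sum {ι : Type*} {s : Finset ι} {f : ι → M → ℝ} {x : M}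
    (hf : ∀ i ∈ s, MDifferentiableAt I 𝓘(ℝ) (f i) x) :
    mvfderiv I (fun y => ∑ i ∈ s, f i y) x = ∑ i ∈ s, mvfderiv I (f i) x := by
  classical
  induction s using Finset.induction_on with
  | empty => simp [mvfderiv_const]
  | insert a s ha ih =>
    simp only [Finset.sum_insert ha]
    rw [mvfderiv_fun_add (hf a (by simp))
      (mdifferentiableAt_finset_sum fun i hi => hf i (by simp [hi])),
      ih fun i hi => hf i (by simp [hi])]

variable [IsManifold I ∞ M]

lemma SmoothRiemannianMetric.contMDiffAt_inner (g : SmoothRiemannianMetric I M) {x : M}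
    {Y Z : Π y : M, TangentSpace I y}
    (hY : ContMDiffAt I (I.prod 𝓘(ℝ, E)) 2 (fun y => (⟨y, Y y⟩ : TangentBundle I M)) x)
    (hZ : ContMDiffAt I (I.prod 𝓘(ℝ, E)) 2 (fun y => (⟨y, Z y⟩ : TangentBundle I M)) x) :
    ContMDiffAt I 𝓘(ℝ) 2 (fun y => g.inner y (Y y) (Z y)) x := by
  have h : ContMDiffAt I (I.prod 𝓘(ℝ)) 2 (fun y =>
      TotalSpace.mk' ℝ (E := Bundle.Trivial M ℝ) y (g.inner y (Y y) (Z y))) x := by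
    apply ContMDiffAt.clm_bundle_apply₂ (F₁ := E) (F₂ := E)
    · exact (g.contMDiff x).of_le ENat.LEInfty.out
    · exact hY
    · exact hZ
  rw [contMDiffAt_totalSpace] at h
  exact h.2

lemma SmoothRiemannianMetric.mdifferentiableAt_inner (g : SmoothRiemannianMetric I M) {x : M}
    {Y Z : Π y : M, TangentSpace I y}
    (hY : MDifferentiableAt I (I.prod 𝓘(ℝ, E)) (fun y => (⟨y, Y y⟩ : TangentBundle I M)) x)
    (hZ : MDifferentiableAt I (I.prod 𝓘(ℝ, E)) (fun y => (⟨y, Z y⟩ : TangentBundle I M)) x) :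
    MDifferentiableAt I 𝓘(ℝ) (fun y => g.inner y (Y y) (Z y)) x := by
  have h : MDifferentiableAt I (I.prod 𝓘(ℝ)) (fun y =>
      TotalSpace.mk' ℝ (E := Bundle.Trivial M ℝ) y (g.inner y (Y y) (Z y))) x := by
    apply MDifferentiableAt.clm_bundle_apply₂ (F₁ := E) (F₂ := E)
    · exact (g.contMDiff x).mdifferentiableAt (by simp)
    · exact hY
    · exact hZ
  rw [mdifferentiableAt_totalSpace] at h
  exact h.2

/-- Levi-Civita connections of the same metric agree on differentiable vector fields. -/
lemma IsLeviCivita.eq_of_mdifferentiableAt [FiniteDimensional ℝ E] {g : SmoothRiemannianMetric I M}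
    {D D' : AffineConnection I M} (hD : IsLeviCivita g D) (hD' : IsLeviCivita g D')
    {x : M} {Z : Π y : M, TangentSpace I y}
    (hZ : MDifferentiableAt I (I.prod 𝓘(ℝ, E)) (fun y => (⟨y, Z y⟩ : TangentBundle I M)) x) :
    D Z x = D' Z x := by
  let A := D.difference D' x
  have hA (Z : Π y : M, TangentSpace I y)
      (hZ : MDifferentiableAt I (I.prod 𝓘(ℝ, E)) (fun y => (⟨y, Z y⟩ : TangentBundle I M)) x) :
      A (Z x) = D Z x - D' Z x :=
    IsCovariantDerivativeOn.difference_apply D.isCovariantDerivativeOnUniv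
      D'.isCovariantDerivativeOnUniv (by trivial) hZ
  have hext (u : TangentSpace I x) := FiberBundle.mdifferentiableAt_extend I E u
  have hself (u : TangentSpace I x) : FiberBundle.extend E u x = u :=
    FiberBundle.extend_apply_self ..
  have symm (u v : TangentSpace I x) : A u v = A v u := by
    have h1 := D.torsion_eq_zero_iff.1 hD.1 (hext u) (hext v)
    have h2 := D'.torsion_eq_zero_iff.1 hD'.1 (hext u) (hext v)
    have h3 := hA _ (hext u)
    have h4 := hA _ (hext v)
    rw [hself] at h3 h4
    rw [hself, hself] at h1 h2
    rw [h3, h4, _root_.sub_apply, _root_.sub_apply]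
    linear_combination (norm := module) h2 - h1
  have anti (u v w : TangentSpace I x) : g.inner x (A u w) v = - g.inner x (A v w) u := by
    have h1 := hD.2 x w _ _ (hext u) (hext v)
    have h2 := hD'.2 x w _ _ (hext u) (hext v)
    have h3 := hA _ (hext u)
    have h4 := hA _ (hext v)
    rw [hself] at h3 h4
    rw [hself, hself] at h1 h2
    rw [h3, h4, g.symm x _ u]
    simp only [_root_.sub_apply, map_sub]
    linarith
  -- The trilinear form `g(A a b, c)` is symmetric in `a, b` and skew in `a, c`, hence zero.
  have hzero (u v : TangentSpace I x) : A u v = 0 := by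
    by_contra hne
    have h : ∀ a b c, g.inner x (A a b) c = 0 := fun a b c => by
      have h1 := anti a c b
      have h2 := anti b a c
      have h3 := anti c b a
      rw [symm c b] at h1
      rw [symm a c] at h2
      rw [symm b a] at h3
      linarith
    exact (g.pos x _ hne).ne' (h _ _ _)
  ext1 v
  have := hzero (Z x) v
  rw [hA Z hZ, _root_.sub_apply] at this
  exact sub_eq_zero.1 this

/-- A global frame of commuting `C²` vector fields which are orthonormal for `g`. -/
structure IsCommutingOrthonormalFrame {ι : Type*} [Fintype ι] [DecidableEq ι]
    (g : SmoothRiemannianMetric I M) (e : ι → Π x : M, TangentSpace I x) : Prop where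
  contMDiff (i : ι) :
    ContMDiff I (I.prod 𝓘(ℝ, E)) 2 (fun y => (⟨y, e i y⟩ : TangentBundle I M))
  orthonormal (x : M) (i j : ι) : g.inner x (e i x) (e j x) = if i = j then 1 else 0
  sum_inner_smul (x : M) (u : TangentSpace I x) : ∑ i, g.inner x u (e i x) • e i x = u
  mlieBracket_eq_zero (x : M) (i j : ι) : mlieBracket I (e i) (e j) x = 0

namespace IsCommutingOrthonormalFrame

variable {ι : Type*} [Fintype ι] [DecidableEq ι] {g : SmoothRiemannianMetric I M}
  {e : ι → Π x : M, TangentSpace I x} (he : IsCommutingOrthonormalFrame g e)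
include he

lemma mdifferentiableAt (x : M) (i : ι) :
    MDifferentiableAt I (I.prod 𝓘(ℝ, E)) (fun y => (⟨y, e i y⟩ : TangentBundle I M)) x :=
  (he.contMDiff i x).mdifferentiableAt (by simp)

lemma inner_sum_smul (x : M) (c : ι → ℝ) (i : ι) :
    g.inner x (∑ j, c j • e j x) (e i x) = c i := by
  simp [he.orthonormal]

lemma inner_eq_sum (x : M) (u v : TangentSpace I x) :
    g.inner x u v = ∑ i, g.inner x u (e i x) * g.inner x v (e i x) := by
  conv_lhs => rw [← he.sum_inner_smul x u]
  simp [g.symm x v]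

/-- The connection for which the fields of the frame are parallel. -/
noncomputable def connection : AffineConnection I M where
  toFun Z x := ∑ i, (mvfderiv I (fun y => g.inner y (Z y) (e i y)) x).smulRight (e i x)
  isCovariantDerivativeOnUniv := by
    constructor
    · intro Y Z x hY hZ _
      rw [← Finset.sum_add_distrib]
      refine Finset.sum_congr rfl fun i _ => ?_
      have := mvfderiv_fun_add (g.mdifferentiableAt_inner hY (he.mdifferentiableAt x i))
        (g.mdifferentiableAt_inner hZ (he.mdifferentiableAt x i))
      ext1 v
      simp [this, add_smul]
    · intro Z f x hZ hf _
      have h (i : ι) := mvfderiv_fun_mul hf (g.mdifferentiableAt_inner hZ (he.mdifferentiableAt x i))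
      ext1 v
      nth_rewrite 1 [← he.sum_inner_smul x (Z x)]
      simp [h, add_smul, Finset.sum_add_distrib, Finset.smul_sum, smul_smul, mul_comm]

lemma connection_apply (Z : Π x : M, TangentSpace I x) (x : M) (v : TangentSpace I x) :
    he.connection Z x v = ∑ i, mvfderiv I (fun y => g.inner y (Z y) (e i y)) x v • e i x := by
  change (∑ i, (mvfderiv I (fun y => g.inner y (Z y) (e i y)) x).smulRight (e i x)) v = _
  simp

lemma connection_frame (x : M) (i : ι) : he.connection (e i) x = 0 := by
  ext1 v
  rw [connection_apply]
  refine Finset.sum_eq_zero fun j _ => ?_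
  simp only [he.orthonormal, mvfderiv_const, _root_.zero_apply, zero_smul]

variable [FiniteDimensional ℝ E]

/-- Torsion is tensorial, so it can be tested on the frame, whose fields are parallel and commute.
Compatibility is the product rule applied to `g(Y, Z) = ∑ g(Y, e i) g(Z, e i)`. -/
lemma isLeviCivita_connection : IsLeviCivita g he.connection := by
  constructor
  · funext x
    have h (i j : ι) : he.connection.torsion x (e i x) (e j x) = 0 := by
      rw [CovariantDerivative.torsion_apply _ (he.mdifferentiableAt x i) (he.mdifferentiableAt x j),
        he.connection_frame, he.connection_frame, he.mlieBracket_eq_zero]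
      simp
    ext u v
    rw [← he.sum_inner_smul x u, ← he.sum_inner_smul x v]
    simp [h]
  · intro x v Y Z hY hZ
    have hc (W : Π y : M, TangentSpace I y) (hW : MDifferentiableAt I (I.prod 𝓘(ℝ, E))
        (fun y => (⟨y, W y⟩ : TangentBundle I M)) x) (i : ι) :=
      g.mdifferentiableAt_inner hW (he.mdifferentiableAt x i)
    simp only [he.inner_eq_sum _ (Y _) (Z _)]
    rw [mvfderiv_finset_sum (f := fun i y => g.inner y (Y y) (e i y) * g.inner y (Z y) (e i y))
      fun i _ => (hc Y hY i).mul (hc Z hZ i), he.inner_eq_sum x _ (Z x), he.inner_eq_sum x (Y x)]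
    simp only [connection_apply, he.inner_sum_smul]
    rw [_root_.sum_apply, ← Finset.sum_add_distrib]
    refine Finset.sum_congr rfl fun i _ => ?_
    rw [mvfderiv_fun_mul (hc Y hY i) (hc Z hZ i)]
    simp
    ring

/-- The covariant derivative of a `C²` field along a `C²` field is differentiable. -/
lemma mdifferentiableAt_connection {x : M} {Y Z : Π y : M, TangentSpace I y}
    (hY : ContMDiffAt I (I.prod 𝓘(ℝ, E)) 2 (fun y => (⟨y, Y y⟩ : TangentBundle I M)) x)
    (hZ : ContMDiffAt I (I.prod 𝓘(ℝ, E)) 2 (fun y => (⟨y, Z y⟩ : TangentBundle I M)) x) :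
    MDifferentiableAt I (I.prod 𝓘(ℝ, E))
      (fun y => (⟨y, he.connection Z y (Y y)⟩ : TangentBundle I M)) x := by
  simp only [connection_apply]
  exact MDifferentiableAt.sum_section fun i _ =>
    (mdifferentiableAt_mvfderiv_apply (g.contMDiffAt_inner hZ (he.contMDiff i x)) hY).smul_section
      (he.mdifferentiableAt x i)

lemma curvature_connection {x : M} {X Y Z : Π y : M, TangentSpace I y}
    (hX : ContMDiffAt I (I.prod 𝓘(ℝ, E)) 2 (fun y => (⟨y, X y⟩ : TangentBundle I M)) x)
    (hY : ContMDiffAt I (I.prod 𝓘(ℝ, E)) 2 (fun y => (⟨y, Y y⟩ : TangentBundle I M)) x)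
    (hZ : ContMDiffAt I (I.prod 𝓘(ℝ, E)) 2 (fun y => (⟨y, Z y⟩ : TangentBundle I M)) x) :
    curvature he.connection X Y Z x = 0 := by
  simp only [curvature, connection_apply, he.inner_sum_smul]
  rw [← Finset.sum_sub_distrib, ← Finset.sum_sub_distrib]
  refine Finset.sum_eq_zero fun i _ => ?_
  rw [← sub_smul, ← sub_smul,
    mvfderiv_mvfderiv_sub_swap (g.contMDiffAt_inner hZ (he.contMDiff i x)) hX hY, sub_self,
    zero_smul]

/-- Every Levi-Civita connection of a metric with a commuting orthonormal frame has zero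
curvature. -/
lemma curvature_eq_zero {D : AffineConnection I M} (hD : IsLeviCivita g D) {x : M}
    {X Y Z : Π y : M, TangentSpace I y}
    (hX : ContMDiffAt I (I.prod 𝓘(ℝ, E)) 2 (fun y => (⟨y, X y⟩ : TangentBundle I M)) x)
    (hY : ContMDiffAt I (I.prod 𝓘(ℝ, E)) 2 (fun y => (⟨y, Y y⟩ : TangentBundle I M)) x)
    (hZ : ContMDiffAt I (I.prod 𝓘(ℝ, E)) 2 (fun y => (⟨y, Z y⟩ : TangentBundle I M)) x) :
    curvature D X Y Z x = 0 := by
  have hLC := he.isLeviCivita_connection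
  -- Uniqueness covers only differentiable fields, so the inner derivatives are compared on a
  -- neighbourhood, and the outer ones use that `∇_V Z` is again differentiable.
  have hDZ : ∀ᶠ y in nhds x, D Z y = he.connection Z y := by
    filter_upwards [(contMDiffAt_iff_contMDiffAt_nhds (by simp)).1 hZ] with y hy
    exact hD.eq_of_mdifferentiableAt hLC (hy.mdifferentiableAt (by simp))
  have key (V : Π y : M, TangentSpace I y) (hV : ContMDiffAt I (I.prod 𝓘(ℝ, E)) 2
      (fun y => (⟨y, V y⟩ : TangentBundle I M)) x) :
      D (fun y => D Z y (V y)) x = he.connection (fun y => he.connection Z y (V y)) x := by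
    have h0 := he.mdifferentiableAt_connection hV hZ
    rw [← hD.eq_of_mdifferentiableAt hLC h0]
    refine D.isCovariantDerivativeOnUniv.congr_of_eventuallyEq
      (h0.congr_of_eventuallyEq ?_) h0 Filter.univ_mem ?_
    · filter_upwards [hDZ] with y hy using by rw [hy]
    · filter_upwards [hDZ] with y hy using by rw [hy]
  have h := he.curvature_connection hX hY hZ
  unfold curvature at h ⊢
  rw [key Y hY, key X hX, hDZ.self_of_nhds]
  exact h

lemma isFlatMetric : IsFlatMetric g :=
  ⟨⟨_, he.isLeviCivita_connection⟩, fun _ hD _ _ _ hX hY hZ x =>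
    he.curvature_eq_zero hD ((hX x).of_le ENat.LEInfty.out)
      ((hY x).of_le ENat.LEInfty.out) ((hZ x).of_le ENat.LEInfty.out)⟩

lemma ricciAt_eq_zero {D : AffineConnection I M} (hD : IsLeviCivita g D) (x : M)
    (u v : TangentSpace I x) : ricciAt D x u v = 0 := by
  refine Finset.sum_eq_zero fun i _ => ?_
  have h : curvatureAt D x (show TangentSpace I x from Module.finBasis ℝ E i) u v = 0 :=
    he.curvature_eq_zero hD (FiberBundle.contMDiffAt_extend I E _)
      (FiberBundle.contMDiffAt_extend I E _) (FiberBundle.contMDiffAt_extend I E _)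
  refine (congrArg (fun w : E => (Module.finBasis ℝ E).repr w i) h).trans ?_
  exact congrArg (· i) (map_zero (Module.finBasis ℝ E).repr)

end IsCommutingOrthonormalFrame

end OrthonormalFrame

/-! ### Left-invariant frames. -/

section LieGroup

open VectorField

/-- `V` is kept purely algebraic so that the model space can be used with the metric at the identity
in place of its own norm. -/
lemma exists_orthonormal_basis_of_posDef {V : Type*} [AddCommGroup V] [Module ℝ V]
    [FiniteDimensional ℝ V] (B : V →ₗ[ℝ] V →ₗ[ℝ] ℝ) (hs : ∀ u v, B u v = B v u)
    (hp : ∀ v, v ≠ 0 → 0 < B v v) :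
    ∃ b : Fin (Module.finrank ℝ V) → V, (∀ i j, B (b i) (b j) = if i = j then 1 else 0) ∧
      ∀ v, ∑ i, B v (b i) • b i = v := by
  let c : InnerProductSpace.Core ℝ V :=
    { inner := fun u v => B u v
      conj_inner_symm := fun u v => by simp [hs u v]
      re_inner_nonneg := fun v => by
        by_cases h : v = 0
        · simp [h]
        · exact (hp v h).le
      add_left := fun u v w => by simp
      smul_left := fun u v r => by simp
      definite := fun v h => by
        by_contra hv
        exact (hp v hv).ne' h }
  let : NormedAddCommGroup V := c.toNormedAddCommGroup
  let : InnerProductSpace ℝ V := InnerProductSpace.ofCore c.toCore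
  let b := stdOrthonormalBasis ℝ V
  refine ⟨b, fun i j => b.inner_eq_ite i j, fun v => ?_⟩
  conv_rhs => rw [← b.sum_repr' v]
  refine Finset.sum_congr rfl fun i _ => ?_
  rw [hs]
  rfl

variable {E : Type*} [NormedAddCommGroup E] [NormedSpace ℝ E]
  {H : Type*} [TopologicalSpace H] {I : ModelWithCorners ℝ E H}
  {G : Type*} [TopologicalSpace G] [ChartedSpace H G] [Group G]

variable (I) in
/-- The derivative at `x` of the left translation by `a`, as an endomorphism of the model space. -/
noncomputable def mfderivMulLeft (a x : G) : E →L[ℝ] E := mfderiv I I (fun y => a * y) x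

lemma mfderivMulLeft_one (x : G) : mfderivMulLeft I 1 x = ContinuousLinearMap.id ℝ E := by
  have h : HasMFDerivAt I I (fun y : G => 1 * y) x (ContinuousLinearMap.id ℝ (TangentSpace I x)) :=
    (hasMFDerivAt_id x).congr_of_eventuallyEq (.of_eq (by funext; simp))
  exact h.mfderiv

variable [LieGroup I ∞ G]

lemma mfderivMulLeft_mul (a b x : G) (v : E) :
    mfderivMulLeft I (a * b) x v = mfderivMulLeft I a (b * x) (mfderivMulLeft I b x v) := by
  have hd (c y : G) : MDifferentiableAt I I (fun z => c * z) y :=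
    (contMDiff_mul_left (I := I) (n := ∞)).mdifferentiableAt (by simp)
  have h := mfderiv_comp (I' := I) x (hd a (b * x)) (hd b x)
  have e : (fun z => a * z) ∘ (fun z => b * z) = fun z : G => a * b * z := by
    funext z; simp [mul_assoc]
  rw [e] at h
  exact congrArg (fun A : E →L[ℝ] E => A v) h

lemma mfderivMulLeft_inv_apply (x : G) (v : E) :
    mfderivMulLeft I x 1 (mfderivMulLeft I x⁻¹ x v) = v := by
  have h := mfderivMulLeft_mul (I := I) x x⁻¹ x v
  rw [mul_inv_cancel, mfderivMulLeft_one, inv_mul_cancel] at h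
  exact h.symm

variable [FiniteDimensional ℝ E]

/-- A left-invariant metric on a Lie group with abelian Lie algebra has a commuting orthonormal
frame. -/
lemma exists_isCommutingOrthonormalFrame (habelian : IsLieAbelian (GroupLieAlgebra I G))
    (g : SmoothRiemannianMetric I G) (hg : IsLeftInvariantTensor g.inner) :
    ∃ e : Fin (Module.finrank ℝ E) → Π x : G, TangentSpace I x,
      IsCommutingOrthonormalFrame g e := by
  have : LieGroup I (minSmoothness ℝ 3) G := by
    rw [minSmoothness_of_isRCLikeNormedField]; infer_instance
  let B (x : G) : E →L[ℝ] E →L[ℝ] ℝ := g.inner x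
  have hB (x : G) (u v : E) : B x (mfderivMulLeft I x 1 u) (mfderivMulLeft I x 1 v) = B 1 u v := by
    have h : B (x * 1) (mfderivMulLeft I x 1 u) (mfderivMulLeft I x 1 v) = B 1 u v := hg x 1 u v
    rwa [mul_one] at h
  obtain ⟨b, hb, hb'⟩ := exists_orthonormal_basis_of_posDef
    (V := E) (LinearMap.mk₂ ℝ (fun u v => B 1 u v) (by simp) (by simp) (by simp) (by simp))
    (g.symm 1) (g.pos 1)
  simp only [LinearMap.mk₂_apply] at hb hb'
  let c (i : Fin (Module.finrank ℝ E)) : GroupLieAlgebra I G := b i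
  refine ⟨fun i => mulInvariantVectorField (c i), ?_, ?_, ?_, ?_⟩
  · intro i
    simpa using contMDiff_mulInvariantVectorField (c i)
  · intro x i j
    exact (hB x (b i) (b j)).trans (hb i j)
  · intro x (u : E)
    have h : ∑ i, B x u (mfderivMulLeft I x 1 (b i)) • mfderivMulLeft I x 1 (b i) = u := by
      -- Translate `u` back to the identity, expand it in the basis there, and push the expansion
      -- forward to `x`.
      conv_rhs => rw [← mfderivMulLeft_inv_apply (I := I) x u,
        ← hb' (mfderivMulLeft I x⁻¹ x u), map_sum]
      refine Finset.sum_congr rfl fun i _ => ?_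
      rw [map_smul, ← hB x, mfderivMulLeft_inv_apply x u]
    exact h
  · intro x i j
    have h : mlieBracket I (mulInvariantVectorField (c i)) (mulInvariantVectorField (c j)) (1 : G)
        = 0 := habelian.trivial (c i) (c j)
    rw [← mulInvariantVector_mlieBracket, h]
    exact map_zero (mfderivMulLeft I x 1)

end LieGroup

/-! ### Existence of a left-invariant metric. -/

section Existence

variable {E : Type*} [NormedAddCommGroup E] [InnerProductSpace ℝ E]
  {H : Type*} [TopologicalSpace H] {I : ModelWithCorners ℝ E H}
  {G : Type*} [TopologicalSpace G] [ChartedSpace H G] [Group G] [LieGroup I ∞ G]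

variable (I G) in
/-- Every Lie group carries a left-invariant Riemannian metric. -/
lemma exists_leftInvariant_metric :
    ∃ g : SmoothRiemannianMetric I G, IsLeftInvariantTensor g.inner := by
  -- The metric is the inner product of the model space pulled back along `φ x : T_x G → T_1 G`. As
  -- `P` is smooth in `A`, smoothness reduces to that of `φ` in coordinates.
  let φ (x : G) : E →L[ℝ] E := mfderivMulLeft I x⁻¹ x
  let J : E →L[ℝ] E →L[ℝ] ℝ := innerSL ℝ
  let P (A : E →L[ℝ] E) : E →L[ℝ] E →L[ℝ] ℝ :=
    ((ContinuousLinearMap.compL ℝ E E ℝ).flip A).comp (J.comp A)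
  have hP : ContDiff ℝ ∞ P :=
    ((ContinuousLinearMap.compL ℝ E E ℝ).flip.contDiff).clm_comp
      (contDiff_const.clm_comp contDiff_id)
  let B (x : G) : E →L[ℝ] E →L[ℝ] ℝ := P (φ x)
  have hB (x : G) (u v : E) : B x u v = inner ℝ (φ x u) (φ x v) := rfl
  have hφ (x : G) (v : E) : mfderivMulLeft I x 1 (φ x v) = v := mfderivMulLeft_inv_apply x v
  refine ⟨{ inner := B, symm := ?_, pos := ?_, isVonNBounded := ?_, contMDiff := ?_ }, ?_⟩
  · intro x u v
    exact real_inner_comm _ _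
  · intro x v hv
    refine real_inner_self_pos.2 fun h : φ x v = 0 => hv ?_
    have := hφ x v
    rw [h, map_zero] at this
    exact this.symm
  · intro x
    change Bornology.IsVonNBounded ℝ {v : E | B x v v < 1}
    rw [NormedSpace.isVonNBounded_iff, isBounded_iff_forall_norm_le]
    refine ⟨‖mfderivMulLeft I x 1‖, fun v hv => ?_⟩
    have h : ‖φ x v‖ ≤ 1 := by
      have h' : B x v v < 1 := hv
      rw [hB, real_inner_self_eq_norm_sq] at h'
      nlinarith [norm_nonneg (φ x v)]
    calc ‖v‖ = ‖mfderivMulLeft I x 1 (φ x v)‖ := by rw [hφ]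
      _ ≤ ‖mfderivMulLeft I x 1‖ * ‖φ x v‖ := ContinuousLinearMap.le_opNorm _ _
      _ ≤ ‖mfderivMulLeft I x 1‖ := mul_le_of_le_one_right (norm_nonneg _) h
  · intro x₀
    rw [contMDiffAt_hom_bundle]
    refine ⟨contMDiffAt_id, ?_⟩
    let Φ := inTangentCoordinates I I id (fun x : G => x⁻¹ * x) φ x₀
    have hΦ : ContMDiffAt I 𝓘(ℝ, E →L[ℝ] E) ∞ Φ x₀ := by
      -- `φ x` is a partial derivative of the smooth map `(x, y) ↦ x⁻¹ y`, taken in `y` at `y = x`.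
      refine ContMDiffAt.mfderiv (n := ∞) (fun x y : G => x⁻¹ * y) id ?_ contMDiffAt_id (by simp)
      exact ((contMDiff_inv I ∞).comp contMDiff_fst).mul contMDiff_snd _
    refine (hP.contMDiff.contMDiffAt.comp x₀ hΦ).congr_of_eventuallyEq ?_
    filter_upwards [(chartAt H x₀).open_source.mem_nhds (mem_chart_source H x₀)] with x hx
    have hx' : x ∈ (trivializationAt E (TangentSpace I : G → Type _) x₀).baseSet := by
      simpa using hx
    ext u v
    refine (inCoordinates_apply_eq₂ (E₃ := Bundle.Trivial G ℝ) hx' hx'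
      (Set.mem_univ _)).trans ?_
    have h (w : E) :
        φ x ((trivializationAt E (TangentSpace I : G → Type _) x₀).symmL ℝ x w) = Φ x w := by
      simp only [Φ]
      rw [inTangentCoordinates_eq _ _ _ hx (by simp),
        TangentBundle.symmL_trivializationAt_eq_core hx]
      simp only [inv_mul_cancel, ContinuousLinearMap.comp_apply, id]
      exact ((tangentBundleCore I G).coordChange_self _ _ (mem_chart_source H (1 : G)) _).symm
    have h' (w : E) :
        φ x ((trivializationAt E (TangentSpace I : G → Type _) x₀).symm x w) = Φ x w :=
      (congrArg (φ x) (Trivialization.symmL_apply (R := ℝ) _ hx' w).symm).trans (h w)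
    have htriv (r : ℝ) :
        (trivializationAt ℝ (Bundle.Trivial G ℝ) x₀).linearMapAt ℝ x r = r := by
      simp only [Bundle.Trivial.fiberBundle_trivializationAt',
        Bundle.Trivial.linearMapAt_trivialization]
      rfl
    exact (htriv _).trans (congrArg₂ (fun a b : E => inner ℝ a b) (h' u) (h' v))
  · intro a x u v
    -- The chain rule and `(a x)⁻¹ a = x⁻¹`.
    have h (u : E) : φ (a * x) (mfderivMulLeft I a x u) = φ x u := by
      simp only [φ]
      rw [← mfderivMulLeft_mul]
      simp
    exact congrArg₂ (fun a b : E => inner ℝ a b) (h u) (h v)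

end Existence

theorem mainTheorem9 {G : Type*} [TopologicalSpace G]
    [ChartedSpace (EuclideanSpace ℝ (Fin 5)) G] [Group G] [LieGroup (𝓡 5) ∞ G]
    (habelian : IsLieAbelian (GroupLieAlgebra (𝓡 5) G)) :
    (∀ T : Π x : G, TangentSpace (𝓡 5) x →L[ℝ] TangentSpace (𝓡 5) x →L[ℝ] ℝ,
      IsLeftInvariantTensor T → (∀ x u v, T x u v = T x v u) →
      ((∃ (g : SmoothRiemannianMetric (𝓡 5) G) (t : ℝ),
          IsLeftInvariantTensor g.inner ∧ t ≠ 0 ∧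
            HasRicciCurvature g (fun x => t ^ 2 • T x)) ↔ T = 0)) ∧
    (∀ g : SmoothRiemannianMetric (𝓡 5) G, IsLeftInvariantTensor g.inner → IsFlatMetric g) := by
  refine ⟨fun T _ _ => ⟨?_, ?_⟩, fun g hg => ?_⟩
  · rintro ⟨g, t, hg, ht, ⟨D, hD⟩, hRic⟩
    obtain ⟨e, he⟩ := exists_isCommutingOrthonormalFrame habelian g hg
    funext x
    ext u v
    have h := hRic D hD x u v
    rw [he.ricciAt_eq_zero hD] at h
    have h' : t ^ 2 * T x u v = 0 := h.symm
    exact (mul_eq_zero.1 h').resolve_left (pow_ne_zero 2 ht)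
  · rintro rfl
    obtain ⟨g, hg⟩ := exists_leftInvariant_metric (𝓡 5) G
    obtain ⟨e, he⟩ := exists_isCommutingOrthonormalFrame habelian g hg
    -- Any non-zero `t` would serve, since both sides vanish.
    refine ⟨g, 1, hg, one_ne_zero, ⟨_, he.isLeviCivita_connection⟩, fun D hD x u v => ?_⟩
    rw [he.ricciAt_eq_zero hD]
    exact (mul_zero ((1 : ℝ) ^ 2)).symm
  · obtain ⟨e, he⟩ := exists_isCommutingOrthonormalFrame habelian g hg
    exact he.isFlatMetric
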